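/- For $f,\phi\in L^2(\mathbb R)$ let $$\mathcal V_\phi f(x,\omega)=\int_{\mathbb R} f(t)\,\overline{\phi(t-x)}\,e^{-2\pi i t\omega}\,dt,\qquad \mathcal A\phi(x,\omega)=e^{\pi i x\omega}\,\mathcal V_\phi\phi(x,\omega),\qquad x,\omega\in\mathbb R,$$ be the short-time Fourier transform of $f$ with window $\phi$ and the ambiguity function of $\phi$. For $B>0$ let $\mathrm{PW}^2_B$ be the set of all functions $f:\mathbb C\to\mathbb C$ for which there is $F\in L^2([-B,B])$ with $f(z)=\int_{-B}^{B}F(\xi)e^{2\pi i\xi z}\,d\xi$ for all $z\in\mathbb C$; for such $f$, $\mathcal V_\phi f$ denotes the short-time Fourier transform of the restriction of $f$ to $\mathbb R$. **Theorem.** Let $B>0$, $c\in(0,\tfrac1{2B}]$, and let $\phi\in L^2(\mathbb R)$ be such that $\mathcal A\phi(0,\omega)\neq0$ and $\mathcal A\phi(c,\omega)\neq0$ for a.e. $\omega\in(-2B,2B)$. Then the following are equivalent for all $f,g\in\mathrm{PW}^2_B$: 1. there is $\alpha\in\mathbb R$ such that $f=e^{i\alpha}g$ (on $\mathbb C$);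 2. $|\mathcal V_\phi f(x,\omega)|=|\mathcal V_\phi g(x,\omega)|$ for all $x,\omega\in\mathbb R$. -/

import Mathlib

open MeasureTheory Set
open scoped ENNReal ComplexConjugate

noncomputable section

/-- The short-time Fourier transform of `f` with window `φ`,
`V_φ f (x, ω) = ∫ f(t) conj(φ(t - x)) e^{-2πitω} dt`. -/
def stft (φ f : ℝ → ℂ) (x ω : ℝ) : ℂ :=
  ∫ t : ℝ, f t * conj (φ (t - x)) * Complex.exp (-(2 * Real.pi * Complex.I * t * ω))

/-- The ambiguity function `A f (x, ω) = e^{πixω} V_f f (x, ω)`. -/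
def ambiguity (f : ℝ → ℂ) (x ω : ℝ) : ℂ :=
  Complex.exp (Real.pi * Complex.I * x * ω) * stft f f x ω

/-- The Paley-Wiener space `PW^p_B` of functions `f : ℂ → ℂ` of the form
`f(z) = ∫_{-B}^{B} F(ξ) e^{2πiξz} dξ` with `F ∈ L^p([-B, B])`. -/
def paleyWiener (p : ℝ≥0∞) (B : ℝ) : Set (ℂ → ℂ) :=
  {f | ∃ F : ℝ → ℂ, MemLp F p (volume.restrict (Icc (-B) B)) ∧
    ∀ z : ℂ, f z = ∫ ξ in (-B)..B, F ξ * Complex.exp (2 * Real.pi * Complex.I * ξ * z)}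

end

/-! For fixed `x`, `ω ↦ V_φ f(x, ω)` is the Fourier transform of `t ↦ f(t) conj(φ(t - x))`, so its
modulus determines the autocorrelation of that product. At lag `-c`, viewed as a function of `x`,
this autocorrelation is the convolution of `conj(f(t)) f(t - c)` with a reflected product of `φ` and
its translate. A Fourier transform in `x` makes it a product with the factor `V_φ φ(c, -ω)`. Since
`conj(f(t)) f(t - c)` has spectrum in `[-2B, 2B]`, where that factor is a.e. nonzero, the data
determine it (`conj_mul_shift_eq_of_norm_stft_eq`).

Lag `0` yields `|f| = |g|` on `ℝ`. Lag `c` makes `f / g` constant along a lattice `t + cℤ` that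
avoids the zeros. As `c ≤ 1 / (2B)` is at least Nyquist-rate sampling,
`eq_const_mul_of_eq_on_lattice` carries the proportionality to `ℂ`. -/

section Fourier

open scoped FourierTransform

/-! ### Plancherel's theorem and autocorrelations -/

/-- The `L²` Fourier transform of a function in `L¹ ∩ L²` is given by the Fourier integral. -/
theorem coeFn_fourier_toLp_of_integrable {u : ℝ → ℂ} (h₁ : Integrable u) (h₂ : MemLp u 2) :
    (𝓕 (h₂.toLp u) : Lp ℂ 2 (volume : Measure ℝ)) =ᵐ[volume] 𝓕 u := by
  have hc : Continuous (𝓕 u) :=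
    VectorFourier.fourierIntegral_continuous Real.continuous_fourierChar (by exact continuous_inner) h₁
  refine ae_eq_of_integral_contDiff_smul_eq ((Lp.memLp _).locallyIntegrable one_le_two)
    hc.locallyIntegrable fun ψ hψ hψc => ?_
  have hψ₁ : HasCompactSupport (Complex.ofRealCLM ∘ ψ) := hψc.comp_left rfl
  have hψ₂ : ContDiff ℝ _ (Complex.ofRealCLM ∘ ψ) := Complex.ofRealCLM.contDiff.comp hψ
  set Ψ : SchwartzMap ℝ ℂ := hψ₁.toSchwartzMap hψ₂ with hΨ
  have h := congrArg (fun T : TemperedDistribution ℝ ℂ => T Ψ)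
    (Lp.fourier_toTemperedDistribution_eq (h₂.toLp u))
  simp only [TemperedDistribution.fourier_apply, Lp.toTemperedDistribution_apply] at h
  have e₁ : ∫ x, ψ x • (𝓕 (h₂.toLp u) : Lp ℂ 2 (volume : Measure ℝ)) x =
      ∫ x, Ψ x • (𝓕 (h₂.toLp u) : Lp ℂ 2 (volume : Measure ℝ)) x := by
    simp [hΨ]
  have e₂ : ∫ x, ψ x • 𝓕 u x = ∫ x, Ψ x • 𝓕 u x := by simp [hΨ]
  have e₃ : ∫ x, (𝓕 Ψ) x • (h₂.toLp u) x = ∫ x, (𝓕 Ψ) x • u x := by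
    refine integral_congr_ae ?_
    filter_upwards [h₂.coeFn_toLp] with x hx
    rw [hx]
  rw [e₁, e₂, ← h, e₃]
  have e₄ := VectorFourier.integral_fourierIntegral_smul_eq_flip (L := innerₗ ℝ)
    Real.continuous_fourierChar continuous_inner (Ψ.integrable (μ := volume)) h₁
  rw [flip_innerₗ] at e₄
  rw [SchwartzMap.fourier_coe]
  exact e₄

/-- **Plancherel's theorem** for Fourier integrals of functions in `L¹ ∩ L²`. -/
theorem integral_conj_fourier_mul_fourier {u v : ℝ → ℂ} (hu₁ : Integrable u) (hu₂ : MemLp u 2)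
    (hv₁ : Integrable v) (hv₂ : MemLp v 2) :
    ∫ ξ, conj (𝓕 u ξ) * 𝓕 v ξ = ∫ t, conj (u t) * v t := by
  have h := Lp.inner_fourier_eq (hu₂.toLp u) (hv₂.toLp v)
  simp only [L2.inner_def] at h
  calc _ = ∫ x, inner ℂ ((𝓕 (hu₂.toLp u) : Lp ℂ 2 (volume : Measure ℝ)) x)
        ((𝓕 (hv₂.toLp v) : Lp ℂ 2 (volume : Measure ℝ)) x) := by
        refine integral_congr_ae ?_
        filter_upwards [coeFn_fourier_toLp_of_integrable hu₁ hu₂,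
          coeFn_fourier_toLp_of_integrable hv₁ hv₂] with x h₁ h₂
        rw [h₁, h₂, RCLike.inner_apply, mul_comm]
    _ = _ := by
        rw [h]
        refine integral_congr_ae ?_
        filter_upwards [hu₂.coeFn_toLp, hv₂.coeFn_toLp] with x h₁ h₂
        rw [h₁, h₂, RCLike.inner_apply, mul_comm]

/-- The Fourier transform of a function in `L¹ ∩ L²` is square integrable. -/
theorem memLp_two_fourier {u : ℝ → ℂ} (hu₁ : Integrable u) (hu₂ : MemLp u 2) : MemLp (𝓕 u) 2 :=
  (memLp_congr_ae (coeFn_fourier_toLp_of_integrable hu₁ hu₂)).1 (Lp.memLp _)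

theorem fourier_comp_add_right {u : ℝ → ℂ} (s ξ : ℝ) :
    𝓕 (fun t => u (t + s)) ξ = Complex.exp (2 * Real.pi * Complex.I * s * ξ) * 𝓕 u ξ := by
  have h := congrFun (VectorFourier.fourierIntegral_comp_add_right (Real.fourierChar) volume
    (innerₗ ℝ) u s) ξ
  refine h.trans ?_
  rw [Circle.smul_def, Real.fourierChar_apply, smul_eq_mul]
  congr 2
  simp
  ring

/-- Functions in `L¹ ∩ L²` with Fourier transforms of equal modulus have equal autocorrelations. -/
theorem autocorrelation_eq_of_norm_fourier_eq {u v : ℝ → ℂ} (hu₁ : Integrable u) (hu₂ : MemLp u 2)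
    (hv₁ : Integrable v) (hv₂ : MemLp v 2) (h : ∀ ξ, ‖𝓕 u ξ‖ = ‖𝓕 v ξ‖) (s : ℝ) :
    ∫ t, conj (u t) * u (t + s) = ∫ t, conj (v t) * v (t + s) := by
  have mp := measurePreserving_add_right (volume : Measure ℝ) s
  rw [← integral_conj_fourier_mul_fourier hu₁ hu₂ (hu₁.comp_add_right s)
      (hu₂.comp_measurePreserving mp),
    ← integral_conj_fourier_mul_fourier hv₁ hv₂ (hv₁.comp_add_right s)
      (hv₂.comp_measurePreserving mp)]
  refine integral_congr_ae (.of_forall fun ξ => ?_)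
  -- Translation only contributes a unimodular factor depending on `s` and `ξ`; what remains is
  -- `|û|²`.
  simp only [fourier_comp_add_right]
  rw [mul_left_comm, mul_left_comm (conj (𝓕 v ξ)), mul_comm (conj _), mul_comm (conj _),
    Complex.mul_conj', Complex.mul_conj', h]

theorem fourier_eq_integral_mul_exp (u : ℝ → ℂ) (ω : ℝ) :
    𝓕 u ω = ∫ t, u t * Complex.exp (-(2 * Real.pi * Complex.I * t * ω)) := by
  rw [Real.fourier_real_eq_integral_exp_smul]
  refine integral_congr_ae (.of_forall fun t => ?_)
  simp only [smul_eq_mul]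
  rw [mul_comm]
  congr 2
  push_cast
  ring

theorem fourier_mul_conj_eq_stft (φ f : ℝ → ℂ) (x ω : ℝ) :
    𝓕 (fun t => f t * conj (φ (t - x))) ω = stft φ f x ω :=
  fourier_eq_integral_mul_exp _ _

theorem continuous_fourier_of_integrable {u : ℝ → ℂ} (h : Integrable u) : Continuous (𝓕 u) :=
  VectorFourier.fourierIntegral_continuous Real.continuous_fourierChar
    (by exact continuous_inner) h

theorem norm_fourier_le (u : ℝ → ℂ) (ξ : ℝ) : ‖𝓕 u ξ‖ ≤ ∫ t, ‖u t‖ :=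
  VectorFourier.norm_fourierIntegral_le_integral_norm _ _ _ _ _

/-- A continuous integrable function with a.e. vanishing Fourier transform vanishes. -/
theorem eq_zero_of_fourier_ae_eq_zero {d : ℝ → ℂ} (hd : Continuous d) (hi : Integrable d)
    (h : 𝓕 d =ᵐ[volume] 0) : d = 0 := by
  rw [← hd.fourierInv_fourier_eq hi ((integrable_congr h).2 (integrable_zero _ _ _))]
  ext x
  rw [Real.fourierInv_congr_ae h]
  simp [Real.fourierInv_eq]

/-! ### Spectra of Paley-Wiener functions and of their shifted products -/

/-- A Paley-Wiener function is, on the real line, the Fourier transform of a function in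
`L¹ ∩ L²` supported in `[-B, B]`. -/
theorem exists_eq_fourier_of_mem_paleyWiener {B : ℝ} (hB : 0 < B) {f : ℂ → ℂ}
    (hf : f ∈ paleyWiener 2 B) :
    ∃ a : ℝ → ℂ, Integrable a ∧ MemLp a 2 ∧ (∀ ξ, B < |ξ| → a ξ = 0) ∧
      (fun t : ℝ => f t) = 𝓕 a := by
  obtain ⟨F, hF, hfF⟩ := hf
  have mp := Measure.measurePreserving_neg (volume : Measure ℝ)
  have h2 : MemLp ((Icc (-B) B).indicator F) 2 := (memLp_indicator_iff_restrict measurableSet_Icc).2 hF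
  have h1 : Integrable ((Icc (-B) B).indicator F) :=
    (integrable_indicator_iff measurableSet_Icc).2 (hF.integrable one_le_two)
  refine ⟨fun ξ => (Icc (-B) B).indicator F (-ξ), h1.comp_neg, h2.comp_measurePreserving mp,
    fun ξ hξ => indicator_of_notMem (fun h => ?_) _, ?_⟩
  · rw [← abs_neg] at hξ
    exact absurd (abs_le.2 h) (not_le.2 hξ)
  · ext t
    rw [← Real.fourierInv_eq_fourier_comp_neg, Real.fourierInv_eq_fourier_neg,
      fourier_eq_integral_mul_exp, hfF, intervalIntegral.integral_of_le (by linarith),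
      ← integral_Icc_eq_integral_Ioc, ← integral_indicator measurableSet_Icc]
    refine integral_congr_ae (.of_forall fun ξ => ?_)
    by_cases h : ξ ∈ Icc (-B) B
    · simp only [indicator_of_mem h]
      congr 2
      push_cast
      ring
    · simp [indicator_of_notMem h]

/-- If `a` is supported in `[-B, B]`, then the spectrum of `t ↦ conj (â t) * â (t - c)` lies in
`[-2B, 2B]`. -/
theorem fourier_conj_mul_shift_eq_zero {B : ℝ} {a : ℝ → ℂ} (h₁ : Integrable a) (h₂ : MemLp a 2)
    (ha : ∀ ξ, B < |ξ| → a ξ = 0) (c ω : ℝ) (hω : 2 * B < |ω|) :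
    𝓕 (fun t => conj (𝓕 a t) * 𝓕 a (t - c)) ω = 0 := by
  -- Modulating `a` translates its transform: `𝓕 b₀ t = 𝓕 a (t - c)`.
  set b₀ : ℝ → ℂ := fun ξ => a ξ * Complex.exp (((2 * Real.pi * c * ξ : ℝ) : ℂ) * Complex.I) with hb₀
  have hcont : Continuous fun ξ : ℝ =>
      Complex.exp (((2 * Real.pi * c * ξ : ℝ) : ℂ) * Complex.I) := by fun_prop
  have hb₀1 : Integrable b₀ := h₁.mul_bdd (c := 1) hcont.aestronglyMeasurable
    (.of_forall fun ξ => by rw [Complex.norm_exp_ofReal_mul_I])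
  have hb₀2 : MemLp b₀ 2 := by
    refine h₂.of_le (h₂.1.mul hcont.aestronglyMeasurable) (.of_forall fun ξ => ?_)
    rw [hb₀]
    simp only [norm_mul, Complex.norm_exp_ofReal_mul_I, mul_one, le_refl]
  have key : ∀ t, 𝓕 a (t - c) * Complex.exp (-(2 * Real.pi * Complex.I * t * ω)) =
      𝓕 (fun ξ => b₀ (ξ + -ω)) t := by
    intro t
    rw [fourier_comp_add_right, mul_comm, fourier_eq_integral_mul_exp, fourier_eq_integral_mul_exp]
    congr 1
    · congr 1; push_cast; ring
    · refine integral_congr_ae (.of_forall fun ξ => ?_)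
      simp only [hb₀]
      rw [mul_assoc (a ξ), ← Complex.exp_add]
      congr 2
      push_cast
      ring
  rw [fourier_eq_integral_mul_exp]
  simp only [mul_assoc (conj _)]
  have mp := measurePreserving_add_right (volume : Measure ℝ) (-ω)
  rw [integral_congr_ae (.of_forall fun t => congrArg (conj (𝓕 a t) * ·) (key t)),
    integral_conj_fourier_mul_fourier h₁ h₂ (hb₀1.comp_add_right _)
      (hb₀2.comp_measurePreserving mp)]
  refine integral_eq_zero_of_ae (.of_forall fun ξ => ?_)
  -- For `|ω| > 2B` the supports of `a` and of its translate by `ω` are disjoint.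
  by_cases h : B < |ξ|
  · simp [ha ξ h]
  · have : B < |ξ + -ω| := by
      have := abs_sub_abs_le_abs_sub ω ξ
      rw [abs_sub_comm] at this
      rw [← sub_eq_add_neg]
      linarith [not_lt.1 h]
    simp [hb₀, ha _ this]

/-! ### From phaseless data to shifted products -/

theorem memLp_mul_conj_shift {φ f : ℝ → ℂ} (hφ : MemLp φ 2) (hc : Continuous f) {C : ℝ}
    (hC : ∀ t, ‖f t‖ ≤ C) (x : ℝ) : MemLp (fun t => f t * conj (φ (t - x))) 2 := by
  have mp := measurePreserving_sub_right (volume : Measure ℝ) x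
  have h : MemLp (fun t => conj (φ (t - x))) 2 := MemLp.star (hφ.comp_measurePreserving mp)
  refine h.of_le_mul (c := C) (hc.aestronglyMeasurable.mul h.1) (.of_forall fun t => ?_)
  rw [norm_mul]
  exact mul_le_mul_of_nonneg_right (hC t) (norm_nonneg _)

theorem integrable_mul_conj_shift {φ f : ℝ → ℂ} (hφ : MemLp φ 2) (hf : MemLp f 2)
    (x : ℝ) : Integrable (fun t => f t * conj (φ (t - x))) := by
  have mp := measurePreserving_sub_right (volume : Measure ℝ) x
  exact hf.integrable_mul (MemLp.star (hφ.comp_measurePreserving mp))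

/-- Phaseless short-time Fourier data determine the product of the spectrum of
`t ↦ conj (f t) * f (t - c)` with the short-time Fourier transform of the window. -/
theorem fourier_conj_mul_shift_mul_stft_eq {φ a b : ℝ → ℂ} (hφ : MemLp φ 2)
    (ha₁ : Integrable a) (ha₂ : MemLp a 2) (hb₁ : Integrable b) (hb₂ : MemLp b 2)
    (h : ∀ x ω : ℝ, ‖stft φ (𝓕 a) x ω‖ = ‖stft φ (𝓕 b) x ω‖) (c ω : ℝ) :
    𝓕 (fun t => conj (𝓕 a t) * 𝓕 a (t - c)) ω * stft φ φ c (-ω) =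
      𝓕 (fun t => conj (𝓕 b t) * 𝓕 b (t - c)) ω * stft φ φ c (-ω) := by
  set Φ : ℝ → ℂ := fun y => φ y * conj (φ (y - c)) with hΦ
  have hΦi : Integrable Φ := integrable_mul_conj_shift hφ hφ c
  have hstft : stft φ φ c (-ω) = 𝓕 (fun y => Φ (-y)) ω := by
    rw [← Real.fourierInv_eq_fourier_comp_neg, Real.fourierInv_eq_fourier_neg, hΦ,
      fourier_mul_conj_eq_stft]
  have hp : ∀ {a : ℝ → ℂ}, Integrable a → MemLp a 2 →
      Integrable fun t => conj (𝓕 a t) * 𝓕 a (t - c) := fun {a} h₁ h₂ =>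
    (MemLp.star (memLp_two_fourier h₁ h₂)).integrable_mul
      ((memLp_two_fourier h₁ h₂).comp_measurePreserving
        (measurePreserving_sub_right (volume : Measure ℝ) c))
  -- Regrouping the four factors exhibits the autocorrelation of `t ↦ 𝓕 a t * conj (φ (t - x))` at
  -- lag `-c`.
  have hconv : ∀ {a : ℝ → ℂ} (x : ℝ),
      convolution (fun t => conj (𝓕 a t) * 𝓕 a (t - c)) (fun y => Φ (-y))
        (ContinuousLinearMap.mul ℂ ℂ) volume x =
      ∫ t, conj (𝓕 a t * conj (φ (t - x))) * (𝓕 a (t + -c) * conj (φ (t + -c - x))) := by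
    intro a x
    refine integral_congr_ae (.of_forall fun t => ?_)
    simp only [hΦ, ContinuousLinearMap.mul_apply', map_mul, Complex.conj_conj, neg_sub,
      ← sub_eq_add_neg, sub_right_comm t c x]
    ring
  rw [hstft, ← Real.fourier_mul_convolution_eq (hp ha₁ ha₂) hΦi.comp_neg,
    ← Real.fourier_mul_convolution_eq (hp hb₁ hb₂) hΦi.comp_neg]
  refine congrArg (fun v : ℝ → ℂ => 𝓕 v ω) (funext fun x => ?_)
  rw [hconv, hconv]
  exact autocorrelation_eq_of_norm_fourier_eq
    (integrable_mul_conj_shift hφ (memLp_two_fourier ha₁ ha₂) x)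
    (memLp_mul_conj_shift hφ (continuous_fourier_of_integrable ha₁) (norm_fourier_le a) x)
    (integrable_mul_conj_shift hφ (memLp_two_fourier hb₁ hb₂) x)
    (memLp_mul_conj_shift hφ (continuous_fourier_of_integrable hb₁) (norm_fourier_le b) x)
    (fun ξ => by simpa only [fourier_mul_conj_eq_stft] using h x ξ) (-c)

/-- The difference of the two products has zero spectrum: outside `[-2B, 2B]` by band limitation,
inside by cancelling the ambiguity factor. Continuity upgrades a.e. equality to every `t`. -/
theorem conj_mul_shift_eq_of_norm_stft_eq {φ a b : ℝ → ℂ} {B : ℝ} (hφ : MemLp φ 2)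
    (ha₁ : Integrable a) (ha₂ : MemLp a 2) (ha : ∀ ξ, B < |ξ| → a ξ = 0)
    (hb₁ : Integrable b) (hb₂ : MemLp b 2) (hb : ∀ ξ, B < |ξ| → b ξ = 0)
    (h : ∀ x ω : ℝ, ‖stft φ (𝓕 a) x ω‖ = ‖stft φ (𝓕 b) x ω‖) {c : ℝ}
    (hA : ∀ᵐ ω ∂(volume.restrict (Ioo (-(2 * B)) (2 * B)) : Measure ℝ), ambiguity φ c ω ≠ 0)
    (t : ℝ) : conj (𝓕 a t) * 𝓕 a (t - c) = conj (𝓕 b t) * 𝓕 b (t - c) := by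
  have hp : ∀ {a : ℝ → ℂ}, Integrable a → MemLp a 2 →
      Integrable fun t => conj (𝓕 a t) * 𝓕 a (t - c) := fun {a} h₁ h₂ =>
    (MemLp.star (memLp_two_fourier h₁ h₂)).integrable_mul
      ((memLp_two_fourier h₁ h₂).comp_measurePreserving
        (measurePreserving_sub_right (volume : Measure ℝ) c))
  have hcont : ∀ {a : ℝ → ℂ}, Integrable a →
      Continuous fun t => conj (𝓕 a t) * 𝓕 a (t - c) := fun {a} h₁ => by
    have := continuous_fourier_of_integrable h₁
    fun_prop
  set d : ℝ → ℂ := (fun t => conj (𝓕 a t) * 𝓕 a (t - c)) -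
    (fun t => conj (𝓕 b t) * 𝓕 b (t - c)) with hd
  have hdF : ∀ ω, 𝓕 d ω = 𝓕 (fun t => conj (𝓕 a t) * 𝓕 a (t - c)) ω -
      𝓕 (fun t => conj (𝓕 b t) * 𝓕 b (t - c)) ω := by
    intro ω
    simp only [Real.fourier_eq, hd, Pi.sub_apply, smul_sub]
    exact integral_sub ((Real.fourierIntegral_convergent_iff ω).2 (hp ha₁ ha₂))
      ((Real.fourierIntegral_convergent_iff ω).2 (hp hb₁ hb₂))
  have hd0 : d = 0 := by
    refine eq_zero_of_fourier_ae_eq_zero ((hcont ha₁).sub (hcont hb₁))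
      ((hp ha₁ ha₂).sub (hp hb₁ hb₂)) ?_
    rw [ae_restrict_iff' measurableSet_Ioo] at hA
    -- The factor to cancel sits at `-ω`, and the interval is symmetric. The endpoints `±2B`,
    -- covered by neither argument, are null.
    have hA' := (Measure.measurePreserving_neg (volume : Measure ℝ)).quasiMeasurePreserving.ae hA
    filter_upwards [hA', compl_mem_ae_iff.2 (measure_singleton (μ := volume) (2 * B)),
      compl_mem_ae_iff.2 (measure_singleton (μ := volume) (-(2 * B)))]
      with ω hω h₁ h₂
    rw [Pi.zero_apply, hdF, sub_eq_zero]
    rcases lt_trichotomy (2 * B) |ω| with hlt | heq | hgt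
    · rw [fourier_conj_mul_shift_eq_zero ha₁ ha₂ ha c ω hlt,
        fourier_conj_mul_shift_eq_zero hb₁ hb₂ hb c ω hlt]
    · rcases abs_choice ω with h' | h' <;> rw [h'] at heq
      · exact absurd heq.symm h₁
      · exact absurd (by rw [mem_singleton_iff, heq, neg_neg]) h₂
    · rw [← abs_neg] at hgt
      exact mul_right_cancel₀ (right_ne_zero_of_mul (hω (abs_lt.1 hgt)))
        (fourier_conj_mul_shift_mul_stft_eq hφ ha₁ ha₂ hb₁ hb₂ h c ω)
  exact sub_eq_zero.1 (congrFun hd0 t)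

end Fourier

/-! ### Sampling and uniqueness on a lattice -/

/-- A square-integrable function on `[-B, B]` whose Fourier integrals vanish on `c ℤ`, with
`c ≤ 1 / (2 * B)`, vanishes almost everywhere. -/
theorem ae_eq_zero_of_integral_exp_eq_zero {B c : ℝ} (hB : 0 < B) (hc : c ∈ Ioc (0 : ℝ) (1 / (2 * B)))
    {D : ℝ → ℂ} (hD : MemLp D 2 (volume.restrict (Icc (-B) B)))
    (h : ∀ k : ℤ, ∫ ξ in (-B)..B, D ξ * Complex.exp (2 * Real.pi * Complex.I * ξ * (k * c)) = 0) :
    D =ᵐ[volume.restrict (Icc (-B) B)] 0 := by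
  have hc0 : 0 < c := hc.1
  set T : ℝ := 1 / c with hT
  have hT0 : 0 < T := by positivity
  have hBT : 2 * B ≤ T := by
    rw [hT, le_div_iff₀ hc0, mul_comm]
    exact (le_div_iff₀ (by positivity)).1 hc.2
  have hlt : -B < -B + T := by linarith
  -- Extended by zero to a period of length `T = 1 / c ≥ 2B`, `D` has the given integrals as Fourier
  -- coefficients up to a factor, so Parseval applies.
  set E : ℝ → ℂ := (Icc (-B) B).indicator D with hE
  have hE2 : MemLp E 2 (volume.restrict (Ioc (-B) (-B + T))) :=
    ((memLp_indicator_iff_restrict measurableSet_Icc).2 hD).restrict _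
  have hcoeff : ∀ n : ℤ, fourierCoeffOn hlt E n = 0 := by
    intro n
    rw [fourierCoeffOn_eq_integral]
    refine smul_eq_zero_of_right _ ?_
    rw [← h (-n), intervalIntegral.integral_of_le hlt.le,
      intervalIntegral.integral_of_le (by linarith : -B ≤ B)]
    have hsub : Ioc (-B) B ⊆ Ioc (-B) (-B + T) := Ioc_subset_Ioc_right (by linarith)
    refine (setIntegral_eq_of_subset_of_forall_sdiff_eq_zero measurableSet_Ioc hsub ?_).trans ?_
    · intro ξ hξ
      have : ξ ∉ Icc (-B) B := fun h' => hξ.2 ⟨hξ.1.1, h'.2⟩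
      simp [hE, indicator_of_notMem this]
    · refine setIntegral_congr_fun measurableSet_Ioc fun ξ hξ => ?_
      simp only [hE, indicator_of_mem (Ioc_subset_Icc_self hξ), fourier_coe_apply, smul_eq_mul]
      rw [mul_comm, add_sub_cancel_left, hT]
      congr 2
      push_cast
      field_simp
  have hsum := hasSum_sq_fourierCoeffOn hlt hE2
  simp only [hcoeff, norm_zero, ne_eq, OfNat.ofNat_ne_zero, not_false_eq_true, zero_pow] at hsum
  have h0 := hsum.unique hasSum_zero
  rw [smul_eq_zero, inv_eq_zero, add_sub_cancel_left, or_iff_right hT0.ne',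
    intervalIntegral.integral_of_le hlt.le,
    integral_eq_zero_iff_of_nonneg (fun _ => by positivity) hE2.integrable_norm_pow'] at h0
  have hsub : Ioc (-B) B ⊆ Ioc (-B) (-B + T) := Ioc_subset_Ioc_right (by linarith)
  rw [restrict_Ioc_eq_restrict_Icc.symm]
  filter_upwards [ae_restrict_of_ae_restrict_of_subset hsub h0, ae_restrict_mem measurableSet_Ioc]
    with ξ h₁ h₂
  simpa [hE, indicator_of_mem (Ioc_subset_Icc_self h₂)] using h₁

/-- Paley-Wiener functions proportional on a translate of `c ℤ`, with `c ≤ 1 / (2 * B)`, are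
proportional on `ℂ`. -/
theorem eq_const_mul_of_eq_on_lattice {B c : ℝ} (hB : 0 < B) (hc : c ∈ Ioc (0 : ℝ) (1 / (2 * B)))
    {f g : ℂ → ℂ} (hf : f ∈ paleyWiener 2 B) (hg : g ∈ paleyWiener 2 B) (t : ℝ) (w : ℂ)
    (h : ∀ k : ℤ, f ((t + k * c : ℝ) : ℂ) = w * g ((t + k * c : ℝ) : ℂ)) (z : ℂ) :
    f z = w * g z := by
  obtain ⟨F, hF, hfF⟩ := hf
  obtain ⟨G, hG, hgG⟩ := hg
  have hint : ∀ {F : ℝ → ℂ} (z : ℂ), MemLp F 2 (volume.restrict (Icc (-B) B)) →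
      IntervalIntegrable (fun ξ => F ξ * Complex.exp (2 * Real.pi * Complex.I * ξ * z))
        volume (-B) B := by
    intro F z hF
    refine IntervalIntegrable.mul_continuousOn ?_ (by fun_prop)
    rw [intervalIntegrable_iff_integrableOn_Icc_of_le (by linarith)]
    exact hF.integrable one_le_two
  have hdiff : ∀ z, f z - w * g z =
      ∫ ξ in (-B)..B, (F ξ - w * G ξ) * Complex.exp (2 * Real.pi * Complex.I * ξ * z) := by
    intro z
    rw [hfF, hgG, ← intervalIntegral.integral_const_mul,
      ← intervalIntegral.integral_sub (hint z hF) ((hint z hG).const_mul w)]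
    congr 1
    ext ξ
    ring
  have hcont : Continuous fun ξ : ℝ =>
      Complex.exp (((2 * Real.pi * ξ * t : ℝ) : ℂ) * Complex.I) := by fun_prop
  -- The modulation by `t` moves the samples from `t + cℤ` to `cℤ`.
  have hD : MemLp (fun ξ => (F ξ - w * G ξ) *
      Complex.exp (((2 * Real.pi * ξ * t : ℝ) : ℂ) * Complex.I)) 2
      (volume.restrict (Icc (-B) B)) := by
    have h' := hF.sub (hG.const_mul w)
    refine h'.of_le (h'.1.mul hcont.aestronglyMeasurable) (.of_forall fun ξ => ?_)
    rw [norm_mul, Complex.norm_exp_ofReal_mul_I, mul_one]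
    rfl
  have hD0 := ae_eq_zero_of_integral_exp_eq_zero hB hc hD fun k => by
    rw [← sub_eq_zero.2 (h k), hdiff]
    congr 1
    ext ξ
    rw [mul_assoc, ← Complex.exp_add]
    congr 2
    push_cast
    ring
  rw [← sub_eq_zero, hdiff, intervalIntegral.integral_of_le (by linarith),
    ← integral_Icc_eq_integral_Ioc]
  refine integral_eq_zero_of_ae ?_
  filter_upwards [hD0] with ξ hξ
  have := (mul_eq_zero.1 hξ).resolve_right (Complex.exp_ne_zero _)
  rw [this, zero_mul, Pi.zero_apply]

/-! ### Analyticity and real zeros -/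

/-- Paley-Wiener functions are entire. -/
theorem differentiable_of_mem_paleyWiener {B : ℝ} (hB : 0 < B) {f : ℂ → ℂ}
    (hf : f ∈ paleyWiener 2 B) : Differentiable ℂ f := by
  obtain ⟨F, hF, hfF⟩ := hf
  obtain rfl : f = fun z => ∫ ξ in Icc (-B) B,
      F ξ * Complex.exp (2 * Real.pi * Complex.I * ξ * z) := by
    ext z
    rw [hfF, intervalIntegral.integral_of_le (by linarith), integral_Icc_eq_integral_Ioc]
  intro z₀
  have hF1 : Integrable F (volume.restrict (Icc (-B) B)) := hF.integrable one_le_two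
  have hmeas : ∀ z : ℂ, AEStronglyMeasurable
      (fun ξ : ℝ => F ξ * Complex.exp (2 * Real.pi * Complex.I * ξ * z))
      (volume.restrict (Icc (-B) B)) := fun z =>
    hF1.1.mul (Continuous.aestronglyMeasurable (by fun_prop))
  have hexp : ∀ z ∈ Metric.ball z₀ 1, ∀ ξ ∈ Icc (-B) B,
      ‖Complex.exp (2 * Real.pi * Complex.I * ξ * z)‖ ≤
        Real.exp (2 * Real.pi * B * (‖z₀‖ + 1)) := by
    intro z hz ξ hξ
    refine (Complex.norm_exp_le_exp_norm _).trans (Real.exp_le_exp.2 ?_)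
    have h₁ : ‖z‖ ≤ ‖z₀‖ + 1 := by
      have := norm_sub_norm_le z z₀
      rw [mem_ball_iff_norm] at hz
      linarith
    have h₂ : |ξ| ≤ B := abs_le.2 hξ
    simp only [norm_mul, Complex.norm_real, Complex.norm_I, Complex.norm_ofNat, mul_one,
      Real.norm_eq_abs, abs_of_pos Real.pi_pos]
    gcongr
  refine (hasDerivAt_integral_of_dominated_loc_of_deriv_le (s := Metric.ball z₀ 1)
    (bound := fun ξ => ‖F ξ‖ *
      (Real.exp (2 * Real.pi * B * (‖z₀‖ + 1)) * (2 * Real.pi * B)))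
    (F' := fun z ξ => F ξ * (Complex.exp (2 * Real.pi * Complex.I * ξ * z) *
      (2 * Real.pi * Complex.I * ξ)))
    (Metric.ball_mem_nhds z₀ one_pos) (.of_forall hmeas) ?_
    (hF1.1.mul (Continuous.aestronglyMeasurable (by fun_prop))) ?_
    (hF1.norm.mul_const _) ?_).2.differentiableAt
  · refine (hF1.norm.mul_const (Real.exp (2 * Real.pi * B * (‖z₀‖ + 1)))).mono (hmeas z₀) ?_
    filter_upwards [ae_restrict_mem measurableSet_Icc] with ξ hξ
    rw [norm_mul, norm_mul, norm_norm, Real.norm_eq_abs, Real.abs_exp]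
    exact mul_le_mul_of_nonneg_left (hexp z₀ (Metric.mem_ball_self one_pos) ξ hξ) (norm_nonneg _)
  · filter_upwards [ae_restrict_mem measurableSet_Icc] with ξ hξ z hz
    have h₂ : |ξ| ≤ B := abs_le.2 hξ
    rw [norm_mul, norm_mul]
    gcongr
    · exact hexp z hz ξ hξ
    · simp only [norm_mul, Complex.norm_real, Complex.norm_I, Complex.norm_ofNat, mul_one,
        Real.norm_eq_abs, abs_of_pos Real.pi_pos]
      gcongr
  · refine .of_forall fun ξ z _ => ?_
    have h := ((hasDerivAt_id z).const_mul (2 * Real.pi * Complex.I * ξ : ℂ)).cexp.const_mul (F ξ)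
    simpa using h

/-- The zeros on the real line of an entire function not vanishing identically there form a
null set. -/
theorem ae_ne_zero_of_differentiable {f : ℂ → ℂ} (hf : Differentiable ℂ f) {t₀ : ℝ}
    (h : f t₀ ≠ 0) : ∀ᵐ t : ℝ, f t ≠ 0 := by
  have ha : AnalyticOnNhd ℝ (fun t : ℝ => f t) univ := fun t _ =>
    ((hf.analyticAt t).restrictScalars (𝕜 := ℝ)).comp (Complex.ofRealCLM.analyticAt t)
  have := ae_restrict_le_codiscreteWithin (μ := (volume : Measure ℝ)) MeasurableSet.univ
    (ha.preimage_zero_mem_codiscreteWithin (x := t₀) h (mem_univ _) isConnected_univ)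
  rwa [Measure.restrict_univ] at this

/-! ### Phase propagation and the equivalence -/

theorem theorem3 (B : ℝ) (hB : 0 < B) (c : ℝ) (hc : c ∈ Ioc (0 : ℝ) (1 / (2 * B)))
    (φ : ℝ → ℂ) (hφ : MemLp φ 2 (volume : Measure ℝ))
    (hA : ∀ᵐ ω ∂(volume.restrict (Ioo (-(2 * B)) (2 * B)) : Measure ℝ),
      ambiguity φ 0 ω ≠ 0 ∧ ambiguity φ c ω ≠ 0)
    (f g : ℂ → ℂ) (hf : f ∈ paleyWiener 2 B) (hg : g ∈ paleyWiener 2 B) :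
    (∃ α : ℝ, ∀ z : ℂ, f z = Complex.exp (Complex.I * α) * g z) ↔
      (∀ x ω : ℝ, ‖stft φ (fun t : ℝ => f t) x ω‖ = ‖stft φ (fun t : ℝ => g t) x ω‖) := by
  constructor
  · rintro ⟨α, hα⟩ x ω
    have : stft φ (fun t : ℝ => f t) x ω =
        Complex.exp (Complex.I * α) * stft φ (fun t : ℝ => g t) x ω := by
      simp only [stft, hα, mul_assoc]
      exact integral_const_mul _ _
    rw [this, norm_mul, mul_comm Complex.I, Complex.norm_exp_ofReal_mul_I, one_mul]
  · intro h
    obtain ⟨a, ha₁, ha₂, ha, hfa⟩ := exists_eq_fourier_of_mem_paleyWiener hB hf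
    obtain ⟨b, hb₁, hb₂, hb, hgb⟩ := exists_eq_fourier_of_mem_paleyWiener hB hg
    rw [hfa, hgb] at h
    have key : ∀ {c : ℝ}, (∀ᵐ ω ∂(volume.restrict (Ioo (-(2 * B)) (2 * B)) : Measure ℝ),
        ambiguity φ c ω ≠ 0) → ∀ t : ℝ,
        conj (f t) * f ((t - c : ℝ) : ℂ) = conj (g t) * g ((t - c : ℝ) : ℂ) := by
      intro c hc t
      have h' := conj_mul_shift_eq_of_norm_stft_eq hφ ha₁ ha₂ ha hb₁ hb₂ hb h hc t
      rwa [← hfa, ← hgb] at h'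
    have hnorm : ∀ t : ℝ, ‖f t‖ = ‖g t‖ := by
      intro t
      have h' := key (hA.mono fun _ h => h.1) t
      rw [sub_zero, Complex.conj_mul', Complex.conj_mul'] at h'
      exact (sq_eq_sq₀ (norm_nonneg _) (norm_nonneg _)).1 (by exact_mod_cast h')
    have hshift := key (hA.mono fun _ h => h.2)
    by_cases hne : ∃ t₀ : ℝ, f t₀ ≠ 0
    · obtain ⟨t₀, ht₀⟩ := hne
      have hae := ae_ne_zero_of_differentiable (differentiable_of_mem_paleyWiener hB hf) ht₀
      -- Countably many translates of the null zero set still leave a `t` whose whole lattice avoids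
      -- zeros of `f`.
      have hall : ∀ᵐ t : ℝ, ∀ k : ℤ, f ((t + k * c : ℝ) : ℂ) ≠ 0 :=
        ae_all_iff.2 fun k => (measurePreserving_add_right (volume : Measure ℝ)
          (k * c)).quasiMeasurePreserving.ae hae
      obtain ⟨t, ht⟩ := hall.exists
      have hg0 : ∀ k : ℤ, g ((t + k * c : ℝ) : ℂ) ≠ 0 := fun k => by
        rw [← norm_ne_zero_iff, ← hnorm, norm_ne_zero_iff]
        exact ht k
      set w : ℤ → ℂ := fun k => f ((t + k * c : ℝ) : ℂ) / g ((t + k * c : ℝ) : ℂ) with hw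
      have hwn : ∀ k, ‖w k‖ = 1 := fun k => by
        rw [hw, norm_div, hnorm, div_self (norm_ne_zero_iff.2 (hg0 k))]
      have hstep : ∀ k, w (k + 1) = w k := by
        intro k
        have h' := hshift (t + (k + 1 : ℤ) * c)
        have e : t + ((k + 1 : ℤ) : ℝ) * c - c = t + k * c := by push_cast; ring
        rw [e] at h'
        have h₁ : f ((t + (k + 1 : ℤ) * c : ℝ) : ℂ) = w (k + 1) * g ((t + (k + 1 : ℤ) * c : ℝ) : ℂ) :=
          (div_mul_cancel₀ _ (hg0 (k + 1))).symm
        have h₂ : f ((t + k * c : ℝ) : ℂ) = w k * g ((t + k * c : ℝ) : ℂ) :=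
          (div_mul_cancel₀ _ (hg0 k)).symm
        rw [h₁, h₂, map_mul] at h'
        -- For unimodular ratios this forces `w (k + 1) = w k`.
        have hc1 : conj (w (k + 1)) * w k = 1 := by
          refine mul_right_cancel₀ (mul_ne_zero ((map_ne_zero (starRingEnd ℂ)).2 (hg0 (k + 1))) (hg0 k)) ?_
          rw [one_mul, ← mul_mul_mul_comm]
          exact h'
        have hc2 : conj (w (k + 1)) * w (k + 1) = 1 := by
          rw [Complex.conj_mul', hwn]
          simp
        exact mul_left_cancel₀ (left_ne_zero_of_mul_eq_one hc2) (hc2.trans hc1.symm)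
      have hconst : ∀ k, w k = w 0 := fun k => by
        induction k with
        | zero => rfl
        | succ i ih => rw [hstep, ih]
        | pred i ih => rw [← ih, ← hstep, sub_add_cancel]
      refine ⟨(w 0).arg, fun z => ?_⟩
      have harg : Complex.exp (Complex.I * (w 0).arg) = w 0 := by
        have := Complex.norm_mul_exp_arg_mul_I (w 0)
        rwa [hwn, Complex.ofReal_one, one_mul, mul_comm] at this
      rw [harg]
      refine eq_const_mul_of_eq_on_lattice hB hc hf hg t (w 0) (fun k => ?_) z
      rw [← hconst k]
      exact (div_mul_cancel₀ _ (hg0 k)).symm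
    -- If `f` vanishes on `ℝ`, so does `g` by equality of moduli; sampling then gives `f = g` on
    -- `ℂ`.
    · push Not at hne
      refine ⟨0, fun z => ?_⟩
      rw [Complex.ofReal_zero, mul_zero, Complex.exp_zero]
      refine eq_const_mul_of_eq_on_lattice hB hc hf hg 0 1 (fun k => ?_) z
      have h' := hnorm (0 + k * c)
      rw [hne, norm_zero, eq_comm, norm_eq_zero] at h'
      rw [h', hne, mul_zero]
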